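/- Let $\mathcal A$ be a $d$-dimensional quantum channel ($d\ge 1$), i.e. a completely positive, trace-preserving linear map from the complex $d\times d$ matrices to themselves. Let $\log$ denote the logarithm to any fixed base $b>1$. For a linear map $\mathcal C$ on the $k\times k$ complex matrices (indexed by an orthonormal basis of a $k$-dimensional space) put $$\beta_2(\mathcal C)=-\log \mathbb E\bigl[\operatorname{Tr}\bigl(\mathcal C(|\phi\rangle\langle\phi|)^2\bigr)\bigr],$$ where $\phi$ is distributed according to the uniform probability measure on the unit sphere of $\mathbb C^k$, and let $$\beta_2^{\mathrm{reg}}(\mathcal A)=\liminf_{n\to\infty}\frac1n\,\beta_2(\mathcal A^{\otimes n}).$$ Let $\mathrm{Choi}(\mathcal A)=\sum_{x,y=1}^{d}\mathcal A(|x\rangle\langle y|)\otimes|x\rangle\langle y|$, where $|1\rangle,\dots,|d\rangle$ is the standard basis of $\mathbb C^d$. Then $$\beta_2^{\mathrm{reg}}(\mathcal A)=2\log d-\log\max\bigl[\operatorname{Tr}\bigl(\mathcal A(\mathbb 1)^2\bigr),\ \operatorname{Tr}\bigl(\mathrm{Choi}(\mathcal A)^2\bigr)\bigr].$$ -/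

import Mathlib

noncomputable section

open scoped Kronecker

/-- Linear maps on the complex matrices with rows and columns indexed by `ι`. -/
abbrev MatrixMap (ι : Type*) := Matrix ι ι ℂ →ₗ[ℂ] Matrix ι ι ℂ

section Channel

open scoped Matrix.Norms.L2Operator MatrixOrder ComplexOrder CStarAlgebra

/-- A quantum channel of dimension `d`: a completely positive, trace preserving linear map from the
complex `d × d` matrices (a C⋆-algebra for the operator norm, ordered by `X ≤ Y` iff `Y - X` is
positive semidefinite) to themselves. -/
structure QuantumChannel (d : ℕ) extends
    Matrix (Fin d) (Fin d) ℂ →CP Matrix (Fin d) (Fin d) ℂ where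
  trace_map' (X : Matrix (Fin d) (Fin d) ℂ) : (toFun X).trace = X.trace

/-- The underlying linear map of a channel. -/
def QuantumChannel.toLin {d : ℕ} (A : QuantumChannel d) : MatrixMap (Fin d) where
  toFun := A.toFun
  map_add' := A.map_add'
  map_smul' := A.map_smul'

end Channel

/-- The Choi matrix `∑ x y, A(|x⟩⟨y|) ⊗ |x⟩⟨y|`. -/
def choiMatrix {d : ℕ} (A : MatrixMap (Fin d)) :
    Matrix (Fin d × Fin d) (Fin d × Fin d) ℂ :=
  ∑ x : Fin d, ∑ y : Fin d, A (Matrix.single x y 1) ⊗ₖ Matrix.single x y (1 : ℂ)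

/-- The tensor power `A^{⊗ n}`. The space `(ℂ^d)^{⊗ n}` has the orthonormal basis
`|x⟩ = |x 0⟩ ⊗ ⋯ ⊗ |x (n - 1)⟩` indexed by `x : Fin n → Fin d`, and `A^{⊗ n}` is the linear map that
sends `|x⟩⟨y| = ⨂ i, |x i⟩⟨y i|` to `⨂ i, A(|x i⟩⟨y i|)`. -/
def tensorPower {d : ℕ} (A : MatrixMap (Fin d)) (n : ℕ) :
    MatrixMap (Fin n → Fin d) where
  toFun M := ∑ x : Fin n → Fin d, ∑ y : Fin n → Fin d,
    M x y • Matrix.of fun a b => ∏ i, A (Matrix.single (x i) (y i) 1) (a i) (b i)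
  map_add' M N := by simp only [Matrix.add_apply, add_smul, Finset.sum_add_distrib]
  map_smul' c M := by
    simp only [Matrix.smul_apply, smul_assoc, Finset.smul_sum, RingHom.id_apply]

/-- `A^{⊗ n}` maps `X 0 ⊗ ⋯ ⊗ X (n - 1)` to `A (X 0) ⊗ ⋯ ⊗ A (X (n - 1))`. -/
theorem tensorPower_product {d : ℕ}
    (A : MatrixMap (Fin d)) (n : ℕ)
    (X : Fin n → Matrix (Fin d) (Fin d) ℂ) :
    tensorPower A n (Matrix.of fun a b => ∏ i, X i (a i) (b i)) =
      Matrix.of fun a b => ∏ i, A (X i) (a i) (b i) := by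
  have key (i : Fin n) (a b : Fin d) :
      A (X i) a b = ∑ x, ∑ y, X i x y * A (Matrix.single x y 1) a b := by
    conv_lhs => rw [Matrix.matrix_eq_sum_single (X i)]
    simp only [map_sum, Matrix.sum_apply]
    refine Finset.sum_congr rfl fun x _ => Finset.sum_congr rfl fun y _ => ?_
    rw [show Matrix.single x y (X i x y) = X i x y • Matrix.single x y (1 : ℂ) by
      simp [Matrix.smul_single], map_smul, Matrix.smul_apply, smul_eq_mul]
  ext a b
  simp only [tensorPower, LinearMap.coe_mk, AddHom.coe_mk, Matrix.sum_apply, Matrix.smul_apply,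
    Matrix.of_apply, smul_eq_mul, key, Fintype.prod_sum, ← Finset.prod_mul_distrib]

/-- The projection `|φ⟩⟨φ|` onto a unit vector `φ`. -/
def pureState {ι : Type*} [Fintype ι] (φ : Metric.sphere (0 : EuclideanSpace ℂ ι) 1) :
    Matrix ι ι ℂ :=
  Matrix.of fun x y => φ.1 x * star (φ.1 y)

/-- The average moment `E[Tr (C(|φ⟩⟨φ|) ^ r)]`, where `φ` is uniformly distributed on the unit sphere
of `ℂ^ι`: the mean value for the surface measure normalized to a probability measure. The trace is a
real number when `C` is a channel. -/
def averageMoment {ι : Type*} [Fintype ι] [DecidableEq ι] (r : ℕ)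
    (C : MatrixMap ι) : ℝ :=
  ⨍ φ : Metric.sphere (0 : EuclideanSpace ℂ ι) 1, ((C (pureState φ)) ^ r).trace.re
    ∂(MeasureTheory.volume : MeasureTheory.Measure (EuclideanSpace ℂ ι)).toSphere

/-- `β_r(C) = (1 - r)⁻¹ log E[Tr (C(|φ⟩⟨φ|) ^ r)]` for integers `r ≥ 2`, with logarithm to base
`b`. -/
def renyiBeta (b : ℝ) {ι : Type*} [Fintype ι] [DecidableEq ι] (r : ℕ)
    (C : MatrixMap ι) : ℝ :=
  1 / (1 - (r : ℝ)) * Real.logb b (averageMoment r C)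

/-- `β_r^reg(A) = liminf_{n → ∞} β_r(A^{⊗ n}) / n`, taken in the extended reals. -/
def renyiBetaReg (b : ℝ) (r : ℕ) {d : ℕ}
    (A : MatrixMap (Fin d)) : EReal :=
  Filter.liminf (fun n : ℕ => ((1 / (n : ℝ) * renyiBeta b r (tensorPower A n) : ℝ) : EReal))
    Filter.atTop

end

/-! A uniform unit vector in `ℂ^k` satisfies `E[|φ⟩⟨φ| ⊗ |φ⟩⟨φ|] = (1 + F) / (k (k + 1))`, with `F`
the swap (`sphereMoment_eq`). Since `Tr(C(|φ⟩⟨φ|)²)` is linear in `|φ⟩⟨φ| ⊗ |φ⟩⟨φ|`, its mean is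
`(Tr(C(1)²) + Tr(Choi(C)²)) / (k (k + 1))`, the identity giving the first trace and the swap the
second (`averageMoment_two`).

Both traces are multiplicative under tensor powers, so for `A^{⊗ n}` the mean is exactly `(uⁿ + vⁿ)
/ (dⁿ (dⁿ + 1))` with `u = Tr(A(1)²)` and `v = Tr(Choi(A)²)`. For a channel `u > 0` and `v ≥ 0`, so
the larger of the two governs the exponential rate (`tendsto_logb_growth`), and the liminf is a
limit.

The moment formula is obtained from three facts: invariance under coordinate phases kills the
unpaired moments, invariance under one reflection per coordinate plane relates the others, and `‖φ‖
= 1` fixes the scale. -/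

noncomputable section
open MeasureTheory Metric

/-! ### Invariance of the surface measure under linear isometries -/

section SphereInvariance

variable {E : Type*} [NormedAddCommGroup E] [InnerProductSpace ℝ E]

/-- The self-map of the unit sphere induced by a linear isometry. -/
def LinearIsometryEquiv.onSphere (f : E ≃ₗᵢ[ℝ] E) (φ : sphere (0 : E) 1) : sphere (0 : E) 1 :=
  ⟨f φ, by simp⟩

theorem LinearIsometryEquiv.continuous_onSphere (f : E ≃ₗᵢ[ℝ] E) : Continuous f.onSphere :=
  (f.continuous.comp continuous_subtype_val).subtype_mk _

/-- `toSphere` measures a set by the volume of the cone over it. A linear isometry commutes with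
scaling, so it pulls cones back to cones, and invariance of volume passes to the sphere. -/
theorem LinearIsometryEquiv.preimage_smul_sphere (f : E ≃ₗᵢ[ℝ] E) (s : Set (sphere (0 : E) 1)) :
    (f ⁻¹' Set.image2 (fun (r : ℝ) (v : E) => r • v) (Set.Ioo 0 1) ((↑) '' s)) =
      Set.image2 (fun (r : ℝ) (v : E) => r • v) (Set.Ioo 0 1) ((↑) '' (f.onSphere ⁻¹' s)) := by
  ext v
  constructor
  · rintro ⟨r, hr, _, ⟨φ, hφ, rfl⟩, h⟩
    refine ⟨r, hr, f.symm φ, ⟨⟨f.symm φ, by simp⟩, ?_, rfl⟩, ?_⟩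
    · simpa [LinearIsometryEquiv.onSphere] using hφ
    · apply f.injective
      simpa using h
  · rintro ⟨r, hr, _, ⟨φ, hφ, rfl⟩, rfl⟩
    exact ⟨r, hr, f φ, ⟨f.onSphere φ, hφ, rfl⟩, by simp⟩

variable [FiniteDimensional ℝ E] [MeasurableSpace E] [BorelSpace E]

theorem LinearIsometryEquiv.measurePreserving_onSphere (f : E ≃ₗᵢ[ℝ] E) :
    MeasurePreserving f.onSphere (volume : Measure E).toSphere (volume : Measure E).toSphere := by
  refine ⟨f.continuous_onSphere.measurable, ?_⟩
  ext s hs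
  rw [Measure.map_apply f.continuous_onSphere.measurable hs,
    Measure.toSphere_apply' _ (f.continuous_onSphere.measurable hs), Measure.toSphere_apply' _ hs]
  congr 1
  change volume (Set.image2 (fun (r : ℝ) (v : E) => r • v) (Set.Ioo 0 1) _) =
    volume (Set.image2 (fun (r : ℝ) (v : E) => r • v) (Set.Ioo 0 1) _)
  rw [← f.preimage_smul_sphere]
  exact f.measurePreserving.measure_preimage_equiv (f := f.toHomeomorph.toMeasurableEquiv) _

theorem LinearIsometryEquiv.average_comp_onSphere (f : E ≃ₗᵢ[ℝ] E) (g : sphere (0 : E) 1 → ℂ) :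
    ⨍ φ, g (f.onSphere φ) ∂(volume : Measure E).toSphere =
      ⨍ φ, g φ ∂(volume : Measure E).toSphere := by
  have hemb : MeasurableEmbedding f.onSphere := by
    refine f.continuous_onSphere.measurableEmbedding fun φ ψ h => ?_
    exact Subtype.ext (f.injective (congrArg Subtype.val h))
  rw [average_eq, average_eq, f.measurePreserving_onSphere.integral_comp hemb]

end SphereInvariance

/-! ### Moments of degree (2, 2) of a uniform unit vector -/

section Moments

variable {ι : Type*} [Fintype ι]

/-- The moment `E[φ x * conj (φ y) * φ z * conj (φ w)]` of a uniformly distributed unit vector. -/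
def sphereMoment (x y z w : ι) : ℂ :=
  ⨍ φ : sphere (0 : EuclideanSpace ℂ ι) 1,
    φ.1 x * star (φ.1 y) * (φ.1 z * star (φ.1 w))
    ∂(volume : Measure (EuclideanSpace ℂ ι)).toSphere

theorem sphereMoment_swap (x y z w : ι) : sphereMoment x y z w = sphereMoment x w z y := by
  unfold sphereMoment
  congr 1
  ext φ
  ring

theorem sphereMoment_comm (x y z w : ι) : sphereMoment x y z w = sphereMoment z w x y := by
  unfold sphereMoment
  congr 1
  ext φ
  ring

theorem sphereMoment_isometry (f : EuclideanSpace ℂ ι ≃ₗᵢ[ℝ] EuclideanSpace ℂ ι) (x y z w : ι) :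
    sphereMoment x y z w = ⨍ φ : sphere (0 : EuclideanSpace ℂ ι) 1,
      f φ x * star (f φ y) * (f φ z * star (f φ w))
      ∂(volume : Measure (EuclideanSpace ℂ ι)).toSphere :=
  (f.average_comp_onSphere fun φ => φ.1 x * star (φ.1 y) * (φ.1 z * star (φ.1 w))).symm

theorem integrable_sphere_of_continuous {g : sphere (0 : EuclideanSpace ℂ ι) 1 → ℂ}
    (hg : Continuous g) : Integrable g (volume : Measure (EuclideanSpace ℂ ι)).toSphere :=
  hg.integrable_of_hasCompactSupport (HasCompactSupport.of_compactSpace g)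

theorem average_finset_sum {α κ : Type*} [MeasurableSpace α] {μ : Measure α} (s : Finset κ)
    (g : κ → α → ℂ) (hg : ∀ i ∈ s, Integrable (g i) μ) :
    ⨍ a, ∑ i ∈ s, g i a ∂μ = ∑ i ∈ s, ⨍ a, g i a ∂μ := by
  simp only [average_eq, integral_finsetSum s hg, Finset.smul_sum]

theorem average_const_mul {α : Type*} [MeasurableSpace α] {μ : Measure α}
    (c : ℂ) (g : α → ℂ) : ⨍ a, c * g a ∂μ = c * ⨍ a, g a ∂μ := by
  simp only [average_eq, integral_const_mul, mul_smul_comm]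

/-- The mean value of a Hermitian form of bidegree `(2, 2)`. -/
theorem average_quartic {κ : Type*} [Fintype κ] (c : κ → ℂ) (x y z w : κ → ι) :
    ⨍ φ : sphere (0 : EuclideanSpace ℂ ι) 1,
      ∑ i, c i * (φ.1 (x i) * star (φ.1 (y i)) * (φ.1 (z i) * star (φ.1 (w i))))
      ∂(volume : Measure (EuclideanSpace ℂ ι)).toSphere =
    ∑ i, c i * sphereMoment (x i) (y i) (z i) (w i) := by
  rw [average_finset_sum]
  · simp only [average_const_mul, sphereMoment]
  · intro i _
    apply integrable_sphere_of_continuous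
    fun_prop

theorem sphere_sum_mul_star (φ : sphere (0 : EuclideanSpace ℂ ι) 1) :
    ∑ x, φ.1 x * star (φ.1 x) = 1 := by
  have h : ‖φ.1‖ = 1 := by simp
  have h' := EuclideanSpace.norm_sq_eq φ.1
  rw [h] at h'
  simp only [Complex.star_def, Complex.mul_conj, Complex.normSq_eq_norm_sq]
  rw [← Complex.ofReal_sum, ← h']
  simp

theorem sum_sphereMoment [Nonempty ι] : ∑ x : ι, ∑ z : ι, sphereMoment x x z z = 1 := by
  have h := average_quartic (fun _ : ι × ι => 1) Prod.fst Prod.fst Prod.snd Prod.snd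
  simp only [one_mul, Fintype.sum_prod_type, ← Finset.mul_sum, sphere_sum_mul_star, mul_one] at h
  rw [← h]
  -- The average of the constant 1 is 1 only for a nonzero measure; this is where nonemptiness of
  -- `ι` enters.
  have : NeZero (volume : Measure (EuclideanSpace ℂ ι)).toSphere :=
    ⟨Measure.toSphere_ne_zero _⟩
  exact average_const _ _

variable [DecidableEq ι]

/-- Multiplication of the coordinate `p` by the imaginary unit. -/
def phaseIsometry (p : ι) : EuclideanSpace ℂ ι ≃ₗᵢ[ℝ] EuclideanSpace ℂ ι :=
  LinearIsometryEquiv.piLpCongrRight 2 fun i =>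
    if i = p then rotation (Circle.exp (Real.pi / 2)) else LinearIsometryEquiv.refl ℝ ℂ

theorem phaseIsometry_apply (p i : ι) (φ : EuclideanSpace ℂ ι) :
    phaseIsometry p φ i = (if i = p then Complex.I else 1) * φ i := by
  have hI : ((Circle.exp (Real.pi / 2) : Circle) : ℂ) = Complex.I := by
    rw [Circle.coe_exp]
    push_cast
    exact Complex.exp_pi_div_two_mul_I
  rw [phaseIsometry, LinearIsometryEquiv.piLpCongrRight_apply]
  by_cases h : i = p
  · simp only [if_pos h, rotation_apply, hI]
  · simp only [if_neg h, one_mul, LinearIsometryEquiv.coe_refl, id]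

theorem sphereMoment_phase (p x y z w : ι) :
    sphereMoment x y z w =
      (if x = p then Complex.I else 1) * star (if y = p then Complex.I else 1) *
      ((if z = p then Complex.I else 1) * star (if w = p then Complex.I else 1)) *
      sphereMoment x y z w := by
  conv_lhs => rw [sphereMoment_isometry (phaseIsometry p)]
  simp only [phaseIsometry_apply, star_mul']
  rw [sphereMoment, ← average_const_mul]
  congr 1
  ext φ
  ring

/-- Unless `{x, z} = {y, w}` as multisets, some coordinate occurs a different number of times
without and with conjugation. The difference is at most 2 in absolute value, so a quarter turn of
that coordinate multiplies the moment by `±i` or `-1`. A sign change would miss the difference 2. -/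
theorem sphereMoment_eq_zero {x y z w : ι} (h₁ : ¬(x = y ∧ z = w)) (h₂ : ¬(x = w ∧ z = y)) :
    sphereMoment x y z w = 0 := by
  have of_factor {c : ℂ} (hc : c ≠ 1) (h : sphereMoment x y z w = c * sphereMoment x y z w) :
      sphereMoment x y z w = 0 := by
    by_contra h0
    exact hc (mul_right_cancel₀ h0 (by rw [one_mul, ← h]))
  have hI : Complex.I ≠ 1 := by simp [Complex.ext_iff]
  have hnI : -Complex.I ≠ 1 := by simp [Complex.ext_iff]
  have hn : (-1 : ℂ) ≠ 1 := by norm_num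
  have hx := sphereMoment_phase x x y z w
  have hz := sphereMoment_phase z x y z w
  have hw := sphereMoment_phase w x y z w
  by_cases hxy : x = y
  · have hzw : z ≠ w := fun h => h₁ ⟨hxy, h⟩
    subst hxy
    by_cases hxz : x = z
    · subst hxz
      exact of_factor hnI (by simpa [hzw] using hw)
    · refine of_factor hI (by simpa [hxz, hzw.symm] using hz)
  · by_cases hxw : x = w
    · subst hxw
      have hzy : z ≠ y := fun h => h₂ ⟨rfl, h⟩
      by_cases hxz : x = z
      · subst hxz
        exact of_factor hI (by simpa [Ne.symm hxy, hzy] using hx)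
      · exact of_factor hI (by simpa [hxz, hzy.symm] using hz)
    · by_cases hxz : x = z
      · subst hxz
        exact of_factor hn (by simpa [Ne.symm hxy, Ne.symm hxw] using hx)
      · exact of_factor hI (by simpa [Ne.symm hxy, Ne.symm hxw, Ne.symm hxz] using hx)

/-- The reflection in the line spanned by `|p⟩ + 2 |q⟩`. -/
def planeReflection (p q : ι) : EuclideanSpace ℂ ι ≃ₗᵢ[ℝ] EuclideanSpace ℂ ι :=
  let R := (Submodule.span ℂ {(EuclideanSpace.single p (1 : ℂ) +
    EuclideanSpace.single q (2 : ℂ) : EuclideanSpace ℂ ι)}).reflection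
  ⟨R.toLinearEquiv.restrictScalars ℝ, R.norm_map⟩

theorem planeReflection_apply {p q : ι} (hpq : p ≠ q) (φ : EuclideanSpace ℂ ι) (i : ι) :
    planeReflection p q φ i =
      2 * ((φ p + 2 * φ q) / 5) * ((if i = p then 1 else 0) + (if i = q then 2 else 0)) - φ i := by
  -- The denominator 5 is `1² + 2²`; on the `p, q` plane the matrix of the reflection is `(1/5) [-3,
  -- 4; 4, 3]`.
  have hnorm : ((‖(EuclideanSpace.single p (1 : ℂ) +
      EuclideanSpace.single q (2 : ℂ) : EuclideanSpace ℂ ι)‖ : ℝ) : ℂ) ^ 2 = 5 := by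
    rw [← Complex.ofReal_pow, @norm_add_sq ℂ]
    simp [EuclideanSpace.inner_single_left, hpq]
    norm_num
  change (Submodule.span ℂ {(EuclideanSpace.single p (1 : ℂ) +
    EuclideanSpace.single q (2 : ℂ) : EuclideanSpace ℂ ι)}).reflection φ i = _
  rw [Submodule.reflection_singleton_apply, RCLike.ofReal_eq_complex_ofReal, hnorm]
  simp only [inner_add_left, EuclideanSpace.inner_single_left, PiLp.sub_apply, PiLp.smul_apply,
    PiLp.add_apply, PiLp.single_apply, map_one, one_mul, smul_eq_mul, Complex.conj_ofNat]
  ring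

theorem planeReflection_apply_left {p q : ι} (hpq : p ≠ q) (φ : EuclideanSpace ℂ ι) :
    planeReflection p q φ p = (-3 * φ p + 4 * φ q) / 5 := by
  rw [planeReflection_apply hpq, if_pos rfl, if_neg hpq]
  ring

theorem planeReflection_apply_right {p q : ι} (hpq : p ≠ q) (φ : EuclideanSpace ℂ ι) :
    planeReflection p q φ q = (4 * φ p + 3 * φ q) / 5 := by
  rw [planeReflection_apply hpq, if_pos rfl, if_neg hpq.symm]
  ring

/-- Mean value of the fourth power of the modulus of a real combination of two coordinates. -/
theorem average_plane {p q : ι} (hpq : p ≠ q) (s t : ℝ) :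
    ⨍ φ : sphere (0 : EuclideanSpace ℂ ι) 1,
      ((s * φ.1 p + t * φ.1 q) / 5) * star ((s * φ.1 p + t * φ.1 q) / 5) *
      (((s * φ.1 p + t * φ.1 q) / 5) * star ((s * φ.1 p + t * φ.1 q) / 5))
      ∂(volume : Measure (EuclideanSpace ℂ ι)).toSphere =
    (s ^ 4 * sphereMoment p p p p + t ^ 4 * sphereMoment q q q q
      + 4 * s ^ 2 * t ^ 2 * sphereMoment p p q q) / 625 := by
  let c : Fin 2 → ℂ := ![s / 5, t / 5]
  let e : Fin 2 → ι := ![p, q]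
  have hint (φ : sphere (0 : EuclideanSpace ℂ ι) 1) :
      ((s * φ.1 p + t * φ.1 q) / 5) * star ((s * φ.1 p + t * φ.1 q) / 5) *
      (((s * φ.1 p + t * φ.1 q) / 5) * star ((s * φ.1 p + t * φ.1 q) / 5)) =
      ∑ i : (Fin 2 × Fin 2) × (Fin 2 × Fin 2),
        (c i.1.1 * c i.1.2 * (c i.2.1 * c i.2.2)) *
        (φ.1 (e i.1.1) * star (φ.1 (e i.1.2)) * (φ.1 (e i.2.1) * star (φ.1 (e i.2.2)))) := by
    simp only [Fintype.sum_prod_type, Fin.sum_univ_two, c, e, Matrix.cons_val_zero,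
      Matrix.cons_val_one]
    simp only [star_div₀, star_add, star_mul', Complex.star_def, Complex.conj_ofReal,
      Complex.conj_ofNat]
    ring
  simp only [hint]
  rw [average_quartic]
  simp only [Fintype.sum_prod_type, Fin.sum_univ_two, c, e, Matrix.cons_val_zero,
    Matrix.cons_val_one]
  have h₁ : sphereMoment p q q p = sphereMoment p p q q := sphereMoment_swap ..
  have h₂ : sphereMoment q p p q = sphereMoment p p q q := by
    rw [sphereMoment_swap, sphereMoment_comm]
  have h₃ : sphereMoment q q p p = sphereMoment p p q q := sphereMoment_comm ..
  rw [h₁, h₂, h₃,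
    sphereMoment_eq_zero (x := p) (y := p) (z := p) (w := q) (by simp [hpq]) (by simp [hpq]),
    sphereMoment_eq_zero (x := p) (y := p) (z := q) (w := p) (by simp [hpq.symm])
      (by simp [hpq.symm]),
    sphereMoment_eq_zero (x := p) (y := q) (z := p) (w := p) (by simp [hpq]) (by simp [hpq]),
    sphereMoment_eq_zero (x := p) (y := q) (z := p) (w := q) (by simp [hpq]) (by simp [hpq]),
    sphereMoment_eq_zero (x := p) (y := q) (z := q) (w := q) (by simp [hpq]) (by simp [hpq]),
    sphereMoment_eq_zero (x := q) (y := p) (z := p) (w := p) (by simp [hpq.symm])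
      (by simp [hpq.symm]),
    sphereMoment_eq_zero (x := q) (y := p) (z := q) (w := p) (by simp [hpq.symm])
      (by simp [hpq.symm]),
    sphereMoment_eq_zero (x := q) (y := p) (z := q) (w := q) (by simp [hpq.symm])
      (by simp [hpq.symm]),
    sphereMoment_eq_zero (x := q) (y := q) (z := p) (w := q) (by simp [hpq]) (by simp [hpq]),
    sphereMoment_eq_zero (x := q) (y := q) (z := q) (w := p) (by simp [hpq.symm])
      (by simp [hpq.symm])]
  ring

/-- A single reflection that mixes the two coordinates with unequal weights already yields both
relations, with rational coefficients. -/
theorem sphereMoment_plane {p q : ι} (hpq : p ≠ q) :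
    sphereMoment p p p p = sphereMoment q q q q ∧
      sphereMoment p p p p = 2 * sphereMoment p p q q := by
  have hp := sphereMoment_isometry (planeReflection p q) p p p p
  have hq := sphereMoment_isometry (planeReflection p q) q q q q
  simp only [planeReflection_apply_left hpq] at hp
  simp only [planeReflection_apply_right hpq] at hq
  have hp' := average_plane hpq (-3) 4
  have hq' := average_plane hpq 4 3
  push_cast at hp' hq'
  rw [hp'] at hp
  rw [hq'] at hq
  have h : sphereMoment p p p p = sphereMoment q q q q := by
    -- With `m_p`, `m_q` the fourth moments and `c` the mixed one, `hp` and `hq` read `625 m_p = 81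
    -- m_p + 256 m_q + 576 c` and `625 m_q = 256 m_p + 81 m_q + 576 c`. Their difference is `800
    -- (m_p - m_q) = 0`; then `hp` becomes `288 m_p = 576 c`.
    linear_combination (25 / 32 : ℂ) * (hp - hq)
  refine ⟨h, ?_⟩
  linear_combination (625 / 288 : ℂ) * hp - (256 / 288 : ℂ) * h

theorem sphereMoment_diag [Nonempty ι] (x z : ι) :
    sphereMoment x x z z =
      (1 / (Fintype.card ι * (Fintype.card ι + 1))) * (1 + if x = z then 1 else 0) := by
  obtain ⟨k, hk⟩ : ∃ k : ℂ, k = Fintype.card ι := ⟨_, rfl⟩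
  rw [← hk]
  have hk0 : k ≠ 0 := by simp [hk]
  have hk1 : k + 1 ≠ 0 := by rw [hk]; exact Nat.cast_add_one_ne_zero _
  obtain ⟨p⟩ := ‹Nonempty ι›
  have hdiag (q : ι) : sphereMoment q q q q = sphereMoment p p p p := by
    by_cases h : p = q
    · rw [h]
    · exact (sphereMoment_plane h).1.symm
  have hgen (x z : ι) :
      sphereMoment x x z z = sphereMoment p p p p / 2 * (1 + if x = z then 1 else 0) := by
    by_cases h : x = z
    · subst h
      rw [hdiag, if_pos rfl]
      ring
    · rw [← hdiag x, (sphereMoment_plane h).2, if_neg h]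
      ring
  -- Summing over the `k²` pairs gives `(m / 2) (k² + k) = 1`, which fixes the common fourth moment
  -- `m`.
  have hsum := sum_sphereMoment (ι := ι)
  generalize sphereMoment p p p p = m at hgen
  simp only [hgen] at hsum
  simp only [← Finset.mul_sum, Finset.sum_add_distrib, Finset.sum_const, Finset.sum_ite_eq,
    Finset.mem_univ, if_true, Finset.card_univ, nsmul_eq_mul, mul_one, ← hk] at hsum
  rw [hgen]
  congr 1
  field_simp
  linear_combination 2 * hsum

/-- The moments of degree `(2, 2)` of the uniform distribution on the unit sphere of `ℂ^ι`. -/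
theorem sphereMoment_eq [Nonempty ι] (x y z w : ι) :
    sphereMoment x y z w = (1 / (Fintype.card ι * (Fintype.card ι + 1))) *
      ((if x = y ∧ z = w then 1 else 0) + (if x = w ∧ z = y then 1 else 0)) := by
  by_cases h₁ : x = y ∧ z = w
  · obtain ⟨rfl, rfl⟩ := h₁
    rw [sphereMoment_diag]
    by_cases h : x = z
    · subst h
      simp only [and_self, if_true]
    · simp only [and_self, if_true, h, false_and, if_false]
  · by_cases h₂ : x = w ∧ z = y
    · obtain ⟨rfl, rfl⟩ := h₂
      have : x ≠ z := fun h => h₁ ⟨h, h.symm⟩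
      rw [sphereMoment_swap, sphereMoment_diag]
      simp [this]
    · rw [sphereMoment_eq_zero h₁ h₂, if_neg h₁, if_neg h₂]
      simp

end Moments

/-! ### The mean purity of the output of a linear map -/

section AverageMoment

variable {ι : Type*} [Fintype ι] [DecidableEq ι]

/-- The coefficient `Tr (C(|x⟩⟨y|) C(|z⟩⟨w|))`. -/
def traceCoeff (C : MatrixMap ι) (x y z w : ι) : ℂ :=
  (C (Matrix.single x y 1) * C (Matrix.single z w 1)).trace

theorem map_eq_sum_single (C : MatrixMap ι) (X : Matrix ι ι ℂ) :
    C X = ∑ x, ∑ y, X x y • C (Matrix.single x y 1) := by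
  conv_lhs => rw [Matrix.matrix_eq_sum_single X]
  simp only [map_sum, ← map_smul, Matrix.smul_single, smul_eq_mul, mul_one]

theorem trace_map_mul_map (C : MatrixMap ι) (X Y : Matrix ι ι ℂ) :
    (C X * C Y).trace =
      ∑ x, ∑ y, ∑ z, ∑ w, X x y * Y z w * traceCoeff C x y z w := by
  rw [map_eq_sum_single C X, map_eq_sum_single C Y]
  simp only [Finset.sum_mul]
  simp only [Finset.mul_sum, Matrix.trace_sum, Matrix.smul_mul, Matrix.mul_smul,
    smul_smul, Matrix.trace_smul, smul_eq_mul, traceCoeff,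
    mul_comm (Y _ _)]

theorem trace_map_one_sq (C : MatrixMap ι) :
    ((C 1) ^ 2).trace = ∑ x, ∑ z, traceCoeff C x x z z := by
  rw [sq, trace_map_mul_map]
  simp [Matrix.one_apply]

/-- The two sums come from the two ways to pair plain with conjugated coordinates: `x = y, z = w`
and `x = w, z = y`. -/
theorem averageMoment_two [Nonempty ι] (C : MatrixMap ι) :
    averageMoment 2 C =
      ((1 / (Fintype.card ι * (Fintype.card ι + 1)) : ℂ) *
        (∑ x, ∑ z, traceCoeff C x x z z + ∑ x, ∑ y, traceCoeff C x y y x)).re := by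
  have hexp (φ : sphere (0 : EuclideanSpace ℂ ι) 1) :
      ((C (pureState φ)) ^ 2).trace = ∑ i : (ι × ι) × (ι × ι),
        traceCoeff C i.1.1 i.1.2 i.2.1 i.2.2 *
        (φ.1 i.1.1 * star (φ.1 i.1.2) * (φ.1 i.2.1 * star (φ.1 i.2.2))) := by
    rw [sq, trace_map_mul_map]
    simp only [Fintype.sum_prod_type, pureState, Matrix.of_apply, mul_comm (traceCoeff ..)]
  have hre : averageMoment 2 C =
      (⨍ φ : sphere (0 : EuclideanSpace ℂ ι) 1, ((C (pureState φ)) ^ 2).trace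
        ∂(volume : Measure (EuclideanSpace ℂ ι)).toSphere).re := by
    rw [averageMoment, average_eq, average_eq, Complex.smul_re]
    congr 1
    refine integral_re (𝕜 := ℂ) (integrable_sphere_of_continuous ?_)
    simp only [hexp]
    fun_prop
  rw [hre]
  congr 1
  simp only [hexp]
  rw [average_quartic]
  simp only [Fintype.sum_prod_type, sphereMoment_eq, mul_add, Finset.sum_add_distrib,
    mul_left_comm (traceCoeff ..), ← Finset.mul_sum]
  congr 2
  · refine Finset.sum_congr rfl fun x _ => ?_
    simp [ite_and]
  · refine Finset.sum_congr rfl fun x _ => ?_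
    simp [ite_and]

end AverageMoment

/-! ### Multiplicativity under tensor powers -/

section TensorPower

variable {d : ℕ}

theorem traceCoeff_tensorPower (A : MatrixMap (Fin d)) (n : ℕ) (x y z w : Fin n → Fin d) :
    traceCoeff (tensorPower A n) x y z w = ∏ i, traceCoeff A (x i) (y i) (z i) (w i) := by
  have hsingle (x y : Fin n → Fin d) : tensorPower A n (Matrix.single x y 1) =
      Matrix.of fun a b => ∏ i, A (Matrix.single (x i) (y i) 1) (a i) (b i) := by
    rw [← tensorPower_product]
    congr 1
    ext a b
    simp only [Matrix.single_apply, Matrix.of_apply, Finset.prod_ite_zero, Finset.prod_const_one]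
    congr 1
    simp [funext_iff, forall_and]
  simp only [traceCoeff, hsingle, Matrix.trace, Matrix.diag, Matrix.mul_apply, Matrix.of_apply,
    Fintype.prod_sum, Finset.prod_mul_distrib]

/-- The second tensor factor contributes `Tr(|x⟩⟨y| |z⟩⟨w|)`, which vanishes unless `z = y` and `w =
x`. -/
theorem trace_choiMatrix_sq (A : MatrixMap (Fin d)) :
    ((choiMatrix A) ^ 2).trace = ∑ x, ∑ y, traceCoeff A x y y x := by
  rw [sq, choiMatrix]
  simp only [Finset.sum_mul]
  simp only [Finset.mul_sum, Matrix.trace_sum, ← Matrix.mul_kronecker_mul,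
    Matrix.trace_kronecker, traceCoeff]
  refine Finset.sum_congr rfl fun x _ => Finset.sum_congr rfl fun y _ => ?_
  rw [Finset.sum_eq_single y, Finset.sum_eq_single x]
  · simp
  · intro z _ hz
    simp [hz.symm]
  · simp
  · intro z _ hz
    refine Finset.sum_eq_zero fun w _ => ?_
    simp [hz.symm]
  · simp

theorem averageMoment_two_tensorPower (hd : 0 < d) (A : MatrixMap (Fin d)) (n : ℕ) :
    averageMoment 2 (tensorPower A n) =
      ((1 / ((d : ℂ) ^ n * ((d : ℂ) ^ n + 1))) *
        (((A 1) ^ 2).trace ^ n + ((choiMatrix A) ^ 2).trace ^ n)).re := by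
  have : Nonempty (Fin d) := ⟨⟨0, hd⟩⟩
  have hpow (c : ℂ) : c ^ n = ∏ _i : Fin n, c := by simp
  rw [averageMoment_two, trace_map_one_sq, trace_choiMatrix_sq, hpow (∑ x, ∑ z, _),
    hpow (∑ x, ∑ y, _)]
  -- Distributivity: a sum over index strings of a product over sites is the product of the one-site
  -- sums.
  simp only [traceCoeff_tensorPower, Fintype.prod_sum, Fintype.card_fun, Fintype.card_fin]
  push_cast
  rfl

end TensorPower

/-! ### Reality and positivity of the two traces for a channel -/

section Channel

open scoped Matrix.Norms.L2Operator MatrixOrder ComplexOrder CStarAlgebra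

variable {d : ℕ}

theorem QuantumChannel.toLin_conjTranspose (A : QuantumChannel d) (X : Matrix (Fin d) (Fin d) ℂ) :
    A.toLin X.conjTranspose = (A.toLin X).conjTranspose :=
  map_star A.toCompletelyPositiveMap X

theorem QuantumChannel.trace_toLin (A : QuantumChannel d) (X : Matrix (Fin d) (Fin d) ℂ) :
    (A.toLin X).trace = X.trace :=
  A.trace_map' X

theorem QuantumChannel.trace_one_sq (A : QuantumChannel d) :
    ((A.toLin 1) ^ 2).trace = ((A.toLin 1).conjTranspose * A.toLin 1).trace := by
  rw [← A.toLin_conjTranspose, Matrix.conjTranspose_one, sq]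

theorem QuantumChannel.trace_one_sq_nonneg (A : QuantumChannel d) :
    0 ≤ ((A.toLin 1) ^ 2).trace := by
  rw [A.trace_one_sq]
  exact (Matrix.posSemidef_conjTranspose_mul_self _).trace_nonneg

/-- The trace is the squared Hilbert–Schmidt norm of `A(1)`, and `A(1)` is nonzero because its trace
is `d`. -/
theorem QuantumChannel.trace_one_sq_ne_zero (hd : 0 < d) (A : QuantumChannel d) :
    ((A.toLin 1) ^ 2).trace ≠ 0 := by
  rw [A.trace_one_sq, Ne, Matrix.trace_conjTranspose_mul_self_eq_zero_iff]
  intro h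
  have htr := A.trace_toLin 1
  rw [h, Matrix.trace_zero, Matrix.trace_one, Fintype.card_fin] at htr
  exact hd.ne' (by exact_mod_cast htr.symm)

/-- Each summand is the squared Hilbert–Schmidt norm of `A(|y⟩⟨x|)`, because `A` commutes with the
adjoint. -/
theorem QuantumChannel.trace_choi_sq_nonneg (A : QuantumChannel d) :
    0 ≤ ((choiMatrix A.toLin) ^ 2).trace := by
  rw [trace_choiMatrix_sq]
  refine Finset.sum_nonneg fun x _ => Finset.sum_nonneg fun y _ => ?_
  have h : A.toLin (Matrix.single x y 1) = (A.toLin (Matrix.single y x 1)).conjTranspose := by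
    rw [← A.toLin_conjTranspose, Matrix.conjTranspose_single, star_one]
  rw [traceCoeff, h]
  exact (Matrix.posSemidef_conjTranspose_mul_self _).trace_nonneg

theorem QuantumChannel.trace_one_sq_re_pos (hd : 0 < d) (A : QuantumChannel d) :
    0 < ((A.toLin 1) ^ 2).trace.re :=
  (Complex.pos_iff.1 (lt_of_le_of_ne A.trace_one_sq_nonneg (A.trace_one_sq_ne_zero hd).symm)).1

theorem QuantumChannel.trace_choi_sq_re_nonneg (A : QuantumChannel d) :
    0 ≤ ((choiMatrix A.toLin) ^ 2).trace.re :=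
  (Complex.nonneg_iff.1 A.trace_choi_sq_nonneg).1

theorem QuantumChannel.averageMoment_two_tensorPower (hd : 0 < d) (A : QuantumChannel d) (n : ℕ) :
    averageMoment 2 (tensorPower A.toLin n) =
      (((A.toLin 1) ^ 2).trace.re ^ n + ((choiMatrix A.toLin) ^ 2).trace.re ^ n) /
        ((d : ℝ) ^ n * ((d : ℝ) ^ n + 1)) := by
  rw [_root_.averageMoment_two_tensorPower hd]
  have ha := Complex.eq_re_of_ofReal_le (r := 0)
    (by simpa only [Complex.ofReal_zero] using A.trace_one_sq_nonneg)
  have hc := Complex.eq_re_of_ofReal_le (r := 0)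
    (by simpa only [Complex.ofReal_zero] using A.trace_choi_sq_nonneg)
  rw [ha, hc]
  simp only [Complex.ofReal_re]
  rw [one_div_mul_eq_div]
  norm_cast

end Channel

/-! ### The exponential growth rate -/

section Limit

open Filter Topology

/-- `n⁻¹ log ((uⁿ + vⁿ) / (Dⁿ (Dⁿ + 1)))` tends to `log (max u v) - 2 log D`. -/
theorem tendsto_logb_growth (b : ℝ) {u v D : ℝ} (hu : 0 < u) (hv : 0 ≤ v) (hD : 1 ≤ D) :
    Tendsto (fun n : ℕ => 1 / (n : ℝ) * Real.logb b ((u ^ n + v ^ n) / (D ^ n * (D ^ n + 1))))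
      atTop (𝓝 (Real.logb b (max u v) - 2 * Real.logb b D)) := by
  have hM : 0 < max u v := hu.trans_le (le_max_left _ _)
  have hD0 : 0 < D := one_pos.trans_le hD
  -- Numerator and denominator each lie within a factor 2 of a pure power: `Mⁿ ≤ uⁿ + vⁿ ≤ 2 Mⁿ`
  -- with `M = max u v`, and `D²ⁿ ≤ Dⁿ (Dⁿ + 1) ≤ 2 D²ⁿ`. The error in the logarithm is thus bounded
  -- uniformly in `n` and disappears after division by `n`.
  have hratio (n : ℕ) : |Real.log ((u ^ n + v ^ n) / (D ^ n * (D ^ n + 1))) -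
      n * (Real.log (max u v) - 2 * Real.log D)| ≤ Real.log 2 := by
    have hDn : 1 ≤ D ^ n := one_le_pow₀ hD
    have hMn : 0 < max u v ^ n := pow_pos hM n
    have hun : 0 < u ^ n := pow_pos hu n
    have hvn : 0 ≤ v ^ n := pow_nonneg hv n
    have hum : u ^ n ≤ max u v ^ n := pow_le_pow_left₀ hu.le (le_max_left _ _) n
    have hvm : v ^ n ≤ max u v ^ n := pow_le_pow_left₀ hv (le_max_right _ _) n
    have hsum : max u v ^ n ≤ u ^ n + v ^ n := by
      rcases max_choice u v with h | h <;> rw [h] <;> linarith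
    have h₁ : Real.log (max u v ^ n) ≤ Real.log (u ^ n + v ^ n) := Real.log_le_log hMn hsum
    have h₂ : Real.log (u ^ n + v ^ n) ≤ Real.log 2 + Real.log (max u v ^ n) := by
      rw [← Real.log_mul two_ne_zero hMn.ne']
      exact Real.log_le_log (by positivity) (by linarith)
    have h₃ : Real.log (D ^ n) ≤ Real.log (D ^ n + 1) :=
      Real.log_le_log (by positivity) (by linarith)
    have h₄ : Real.log (D ^ n + 1) ≤ Real.log 2 + Real.log (D ^ n) := by
      rw [← Real.log_mul two_ne_zero (by positivity)]
      exact Real.log_le_log (by positivity) (by linarith)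
    rw [Real.log_div (by positivity) (by positivity), Real.log_mul (by positivity) (by positivity)]
    rw [Real.log_pow] at h₁ h₂ h₃ h₄
    rw [abs_le, Real.log_pow]
    constructor <;> nlinarith
  have hlim : Tendsto (fun n : ℕ => (Real.log 2 / |Real.log b|) / (n : ℝ)) atTop (𝓝 0) :=
    tendsto_const_div_atTop_nhds_zero_nat _
  rw [tendsto_iff_norm_sub_tendsto_zero]
  refine squeeze_zero' (Eventually.of_forall fun n => norm_nonneg _) ?_ hlim
  filter_upwards [eventually_gt_atTop 0] with n hn
  have hn' : (0 : ℝ) < n := Nat.cast_pos.2 hn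
  have heq : 1 / (n : ℝ) * Real.logb b ((u ^ n + v ^ n) / (D ^ n * (D ^ n + 1))) -
      (Real.logb b (max u v) - 2 * Real.logb b D) =
      (Real.log ((u ^ n + v ^ n) / (D ^ n * (D ^ n + 1))) -
        n * (Real.log (max u v) - 2 * Real.log D)) / Real.log b / n := by
    simp only [Real.logb]
    field_simp
  rw [heq, Real.norm_eq_abs, abs_div, abs_div, abs_of_pos hn']
  gcongr
  exact hratio n

end Limit

end

theorem mainTheorem6 (b : ℝ) (hb : 1 < b) (d : ℕ) (hd : 0 < d) (A : QuantumChannel d) :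
    renyiBetaReg b 2 A.toLin =
      ((2 * Real.logb b d -
        Real.logb b (max ((A.toLin 1) ^ 2).trace.re ((choiMatrix A.toLin) ^ 2).trace.re) : ℝ) :
        EReal) := by
  have hu : 0 < ((A.toLin 1) ^ 2).trace.re := A.trace_one_sq_re_pos hd
  have hv : 0 ≤ ((choiMatrix A.toLin) ^ 2).trace.re := A.trace_choi_sq_re_nonneg
  -- The negation is the prefactor `1 / (1 - r) = -1` at `r = 2`.
  have h := (tendsto_logb_growth b hu hv (Nat.one_le_cast.2 hd : (1 : ℝ) ≤ d)).neg
  rw [neg_sub] at h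
  refine Filter.Tendsto.liminf_eq ((continuous_coe_real_ereal.tendsto _).comp (h.congr fun n => ?_))
  rw [renyiBeta, A.averageMoment_two_tensorPower hd]
  norm_num
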